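/- Let $S$ be a finite or countable set with $|S|>1$, and let $P(y|x)$, $x,y\in S$, be the transition probabilities of an irreducible Markov chain on $S$ with stationary distribution $\pi$. Let $\alpha(x)=\sum_{y\neq x}P(y|x)=1-P(x|x)$ be the escape probability from $x$ (which is positive for every $x$), and let $\widehat P$ be the transition probabilities of the jump chain: $\widehat P(x|x)=0$, and $\widehat P(y|x)=P(y|x)/\alpha(x)$ for $y\neq x$. Let $J_1,J_2,\dots$ be a Markov chain on $S$ with transition probabilities $\widehat P$ and an arbitrary initial distribution. Then for every function $h:S\to\mathbf R$ with $\pi|h|:=\sum_{x\in S}|h(x)|\,\pi(x)<\infty$, $$\lim_{L\to\infty}\frac{\sum_{k=1}^{L} h(J_k)/\alpha(J_k)}{\sum_{k=1}^{L} 1/\alpha(J_k)}=\pi(h):=\sum_{x\in S}h(x)\,\pi(x)\qquad\text{with probability }1.$$ -/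

import Mathlib

open MeasureTheory Filter Topology

noncomputable section

namespace JumpChain

/-- `p` is a probability distribution on the discrete space `S`. -/
structure IsDistribution {S : Type*} (p : S → ℝ) : Prop where
  nonneg : ∀ x, 0 ≤ p x
  hasSum_one : HasSum p 1

/-- Transition probabilities of a Markov chain: `P x y` is the probability `P(y | x)` of
moving from `x` to `y`, so each `P x` is a probability distribution. -/
def IsTransition {S : Type*} (P : S → S → ℝ) : Prop :=
  ∀ x, IsDistribution (P x)

/-- Irreducibility: any state can be reached from any state along a path
`x = x₀, x₁, …, xₘ = y` all of whose steps have positive probability. -/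
def Irreducible {S : Type*} (P : S → S → ℝ) : Prop :=
  ∀ x y, Relation.ReflTransGen (fun a b => 0 < P a b) x y

/-- `π` is a stationary distribution for `P`: it is a probability distribution with
`∑ₓ π(x) P(y | x) = π(y)` for every `y`. -/
structure IsStationary {S : Type*} (P : S → S → ℝ) (π : S → ℝ) : Prop where
  isDistribution : IsDistribution π
  hasSum_eq : ∀ y, HasSum (fun x => π x * P x y) (π y)

/-- The escape probability `α(x) = 1 - P(x | x)`. -/
def escape {S : Type*} (P : S → S → ℝ) (x : S) : ℝ := 1 - P x x

open Classical in
/-- The transition probabilities of the jump chain: `P̂(x | x) = 0`, and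
`P̂(y | x) = P(y | x) / α(x)` for `y ≠ x`. -/
def jump {S : Type*} (P : S → S → ℝ) (x y : S) : ℝ :=
  if y = x then 0 else P x y / escape P x

/-- On the probability space `(Ω, μ)`, the sequence `J 0, J 1, …` of random variables with values
in the discrete space `S` is a time-homogeneous Markov chain with transition probabilities `Q`:
given the whole past `J 0 = x 0, …, J n = x n`, the next state is `x (n + 1)` with probability
`Q (x n) (x (n + 1))`. The law of `J 0` is arbitrary. -/
structure IsMarkovChain {S Ω : Type*} [MeasurableSpace Ω] (μ : Measure Ω)
    (Q : S → S → ℝ) (J : ℕ → Ω → S) : Prop where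
  measurableSet_eq : ∀ n x, MeasurableSet {ω | J n ω = x}
  step : ∀ (n : ℕ) (x : ℕ → S),
    μ.real {ω | ∀ i ≤ n + 1, J i ω = x i} =
      μ.real {ω | ∀ i ≤ n, J i ω = x i} * Q (x n) (x (n + 1))

end JumpChain

end

/-!
The masses `w x = π x * α x` are invariant under the jump chain, because the invariance of `π`
under `P` remains true after removing the diagonal terms `π x * P x x` from both sides
(`JumpChain.IsStationary.hasSum_jump`). Their total is at most `1`, however small `α` is. Since
`∑ w * (h / α) = π(h)` and `∑ w * (1 / α) = 1`, the claim is the ratio ergodic theorem for the jump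
chain with the functions `h / α` and `1 / α`, where the second one is at least `1`
(`JumpChain.IsMarkovChain.ae_tendsto_sum_div_sum`).

That theorem is obtained from the shift on path space. Started from `w`, the chain makes the shift
measure preserving, and the shift is ergodic (`ergodic_pathShift`): the probability `φ x` of an
invariant event `A` for the chain started at `x` is a bounded harmonic function of `x`, so that by
invariance of `w` its one-step conditional variance vanishes (`eq_of_harmonic`) and it is constant
by irreducibility; by the Markov property `A` is then independent of every cylinder, hence of
itself.

For an ergodic map, the Birkhoff sums of a function with negative integral are bounded above a.e.
by the maximal ergodic theorem (`ae_bddAbove_birkhoffSum_of_integral_neg`). Applied to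
`f - c * g` with `g ≥ 1`, this bounds the ratio of the sums of `f` and `g` asymptotically by any `c`
above the ratio of the integrals, and by symmetry it gives convergence
(`ae_tendsto_birkhoffSum_div`).

Finally, as `w` is positive everywhere, what holds almost surely for the chain started from `w`
holds almost surely for every starting point, and so for every initial distribution
(`ae_mixedPathLaw_of_ae`); the law of a Markov chain on an arbitrary probability space is determined
by its initial distribution (`JumpChain.IsMarkovChain.map_path`).
-/

/-! ### The maximal and the ratio ergodic theorem -/

section Ergodic

variable {α : Type*}

/-- The maximal Birkhoff sum `max_{0 ≤ k ≤ n} (f x + f (T x) + ⋯ + f (T^[k-1] x))`, given by the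
recursion obtained from splitting off the first summand; the value is nonnegative because the
empty sum competes. -/
noncomputable def maxBirkhoffSum (T : α → α) (f : α → ℝ) : ℕ → α → ℝ
  | 0, _ => 0
  | n + 1, x => max 0 (f x + maxBirkhoffSum T f n (T x))

variable {T : α → α} {f g : α → ℝ}

lemma maxBirkhoffSum_nonneg (n : ℕ) (x : α) : 0 ≤ maxBirkhoffSum T f n x := by
  cases n with
  | zero => exact le_rfl
  | succ n => exact le_max_left _ _

lemma maxBirkhoffSum_le_succ (n : ℕ) (x : α) :
    maxBirkhoffSum T f n x ≤ maxBirkhoffSum T f (n + 1) x := by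
  induction n generalizing x with
  | zero => exact maxBirkhoffSum_nonneg _ _
  | succ n ih => exact max_le_max le_rfl (by linarith [ih (T x)])

lemma birkhoffSum_le_maxBirkhoffSum (n : ℕ) (x : α) :
    birkhoffSum T f n x ≤ maxBirkhoffSum T f n x := by
  induction n generalizing x with
  | zero => simp [maxBirkhoffSum]
  | succ n ih =>
    rw [birkhoffSum_succ']
    exact le_max_of_le_right (by linarith [ih (T x)])

variable [MeasurableSpace α] {μ : Measure α}

lemma measurable_maxBirkhoffSum (hT : Measurable T) (hf : Measurable f) (n : ℕ) :
    Measurable (maxBirkhoffSum T f n) := by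
  induction n with
  | zero => exact measurable_const
  | succ n ih => exact measurable_const.max (hf.add (ih.comp hT))

lemma integrable_maxBirkhoffSum (hT : MeasurePreserving T μ μ) (hf : Integrable f μ) (n : ℕ) :
    Integrable (maxBirkhoffSum T f n) μ := by
  induction n with
  | zero => exact integrable_zero _ _ _
  | succ n ih =>
    exact (integrable_zero α ℝ μ).sup (hf.add (hT.integrable_comp_of_integrable ih))

/-- The maximal ergodic theorem, by Garsia's argument: where the maximal sum is positive, `f` equals
`maxBirkhoffSum T f (n + 1) - maxBirkhoffSum T f n ∘ T`, and elsewhere this difference is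
nonpositive. -/
lemma setIntegral_maxBirkhoffSum_pos_nonneg (hT : MeasurePreserving T μ μ) (hfm : Measurable f)
    (hf : Integrable f μ) (n : ℕ) :
    0 ≤ ∫ x in {x | 0 < maxBirkhoffSum T f (n + 1) x}, f x ∂μ := by
  have hM := integrable_maxBirkhoffSum hT hf
  have hMT : Integrable (fun x => maxBirkhoffSum T f n (T x)) μ :=
    hT.integrable_comp_of_integrable (hM n)
  have hmeas : MeasurableSet {x | 0 < maxBirkhoffSum T f (n + 1) x} :=
    measurableSet_lt measurable_const (measurable_maxBirkhoffSum hT.measurable hfm _)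
  calc
    0 ≤ ∫ x, maxBirkhoffSum T f (n + 1) x ∂μ - ∫ x, maxBirkhoffSum T f n x ∂μ :=
      sub_nonneg.2 (integral_mono (hM n) (hM (n + 1)) (maxBirkhoffSum_le_succ n))
    _ = ∫ x, maxBirkhoffSum T f (n + 1) x - maxBirkhoffSum T f n (T x) ∂μ := by
      rw [integral_sub (hM _) hMT]
      congr 1
      have := integral_map (μ := μ) (φ := T) hT.measurable.aemeasurable
        (f := maxBirkhoffSum T f n)
        (measurable_maxBirkhoffSum hT.measurable hfm n).aestronglyMeasurable
      rwa [hT.map_eq] at this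
    _ ≤ ∫ x in {x | 0 < maxBirkhoffSum T f (n + 1) x}, f x ∂μ := by
      rw [← integral_indicator hmeas]
      refine integral_mono ((hM _).sub hMT) (hf.indicator hmeas) fun x => ?_
      by_cases hx : 0 < maxBirkhoffSum T f (n + 1) x
      · rw [Set.indicator_of_mem (by exact hx)]
        have : maxBirkhoffSum T f (n + 1) x = f x + maxBirkhoffSum T f n (T x) :=
          (max_choice 0 (f x + maxBirkhoffSum T f n (T x))).resolve_left hx.ne'
        simp [this]
      · rw [Set.indicator_of_notMem (by exact hx)]
        have := maxBirkhoffSum_nonneg (T := T) (f := f) n (T x)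
        change maxBirkhoffSum T f (n + 1) x - maxBirkhoffSum T f n (T x) ≤ 0
        linarith [not_lt.1 hx]

/-- The consequence of the maximal ergodic theorem for an infinite horizon: if almost every point
has some positive Birkhoff sum, the sets on which the maximal sums are positive exhaust the space. -/
lemma integral_nonneg_of_ae_exists_birkhoffSum_pos (hT : MeasurePreserving T μ μ)
    (hfm : Measurable f) (hf : Integrable f μ)
    (hpos : ∀ᵐ x ∂μ, ∃ n, 0 < birkhoffSum T f n x) : 0 ≤ ∫ x, f x ∂μ := by
  set A : ℕ → Set α := fun n => {x | 0 < maxBirkhoffSum T f (n + 1) x} with hA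
  have hmeas : ∀ n, MeasurableSet (A n) := fun n =>
    measurableSet_lt measurable_const (measurable_maxBirkhoffSum hT.measurable hfm _)
  have hmono : Monotone A := monotone_nat_of_le_succ fun n x hx =>
    lt_of_lt_of_le hx (maxBirkhoffSum_le_succ (n + 1) x)
  have hlim := tendsto_setIntegral_of_monotone (μ := μ) (f := f) hmeas hmono hf.integrableOn
  have huniv : (⋃ n, A n) =ᵐ[μ] Set.univ := by
    refine eventuallyEq_univ.2 ?_
    filter_upwards [hpos] with x ⟨n, hn⟩
    exact Set.mem_iUnion.2 ⟨n, hn.trans_le ((birkhoffSum_le_maxBirkhoffSum n x).trans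
      (maxBirkhoffSum_le_succ n x))⟩
  rw [setIntegral_congr_set huniv, setIntegral_univ] at hlim
  exact ge_of_tendsto' hlim fun n => setIntegral_maxBirkhoffSum_pos_nonneg hT hfm hf n

/-- If `f` has negative mean, its Birkhoff sums are a.e. bounded above: the set where they are
unbounded is invariant, and by the maximal ergodic theorem it cannot be conull. -/
lemma ae_bddAbove_birkhoffSum_of_integral_neg (hT : Ergodic T μ) (hfm : Measurable f)
    (hf : Integrable f μ) (hneg : ∫ x, f x ∂μ < 0) :
    ∀ᵐ x ∂μ, BddAbove (Set.range fun n => birkhoffSum T f n x) := by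
  have hSm : ∀ n, Measurable (birkhoffSum T f n) := fun n =>
    Finset.measurable_sum _ fun k _ => hfm.comp (hT.measurable.iterate k)
  have hmeas : MeasurableSet {x | BddAbove (Set.range fun n => birkhoffSum T f n x)} :=
    measurableSet_bddAbove_range hSm
  have hinv : T ⁻¹' {x | BddAbove (Set.range fun n => birkhoffSum T f n x)} =
      {x | BddAbove (Set.range fun n => birkhoffSum T f n x)} := by
    ext x
    simp only [Set.mem_preimage, Set.mem_ofPred_eq, bddAbove_def, Set.forall_mem_range]
    constructor
    · rintro ⟨B, hB⟩
      refine ⟨max 0 (f x + B), fun n => ?_⟩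
      cases n with
      | zero => simp
      | succ n => rw [birkhoffSum_succ']; exact le_max_of_le_right (by linarith [hB n])
    · rintro ⟨B, hB⟩
      refine ⟨B - f x, fun n => ?_⟩
      have := hB (n + 1)
      rw [birkhoffSum_succ'] at this
      linarith
  rcases eventuallyConst_set.1 (hT.aeconst_set hmeas hinv) with h | h
  · exact h
  · refine absurd (integral_nonneg_of_ae_exists_birkhoffSum_pos hT.toMeasurePreserving hfm hf ?_)
      (not_le.2 hneg)
    filter_upwards [h] with x hx
    by_contra! hle
    exact hx ⟨0, Set.forall_mem_range.2 hle⟩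

/-- Half of the ratio ergodic theorem: the ratio is eventually below any `c` above the ratio of the
integrals. -/
lemma ae_eventually_birkhoffSum_div_lt (hT : Ergodic T μ) (hfm : Measurable f)
    (hf : Integrable f μ) (hgm : Measurable g) (hg : Integrable g μ) (hg1 : ∀ x, 1 ≤ g x)
    {c : ℝ} (hc : ∫ x, f x ∂μ < c * ∫ x, g x ∂μ) :
    ∀ᵐ x ∂μ, ∀ b > c, ∀ᶠ n in atTop, birkhoffSum T f n x / birkhoffSum T g n x < b := by
  have hneg : ∫ x, (f x - c * g x) ∂μ < 0 := by
    rw [integral_sub hf (hg.const_mul c), integral_const_mul]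
    linarith
  filter_upwards [ae_bddAbove_birkhoffSum_of_integral_neg (f := fun x => f x - c * g x) hT
    (hfm.sub (hgm.const_mul c)) (hf.sub (hg.const_mul c)) hneg] with x ⟨B, hB⟩ b hb
  have hgn : ∀ n : ℕ, (n : ℝ) ≤ birkhoffSum T g n x := fun n => by
    simpa [birkhoffSum] using
      Finset.card_nsmul_le_sum (Finset.range n) (fun k => g (T^[k] x)) 1 fun k _ => hg1 _
  have hlarge : ∀ᶠ n : ℕ in atTop, B / (b - c) < n :=
    tendsto_natCast_atTop_atTop.eventually_gt_atTop _
  filter_upwards [hlarge, eventually_gt_atTop 0] with n hn hn0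
  have hS : birkhoffSum T f n x - c * birkhoffSum T g n x ≤ B := by
    have : birkhoffSum T f n x - c * birkhoffSum T g n x
        = birkhoffSum T (fun x => f x - c * g x) n x := by
      simp [birkhoffSum, Finset.mul_sum]
    rw [this]
    exact hB ⟨n, rfl⟩
  have hpos : 0 < birkhoffSum T g n x := (Nat.cast_pos.2 hn0).trans_le (hgn n)
  have h1 : B < (b - c) * birkhoffSum T g n x := by
    rw [div_lt_iff₀ (sub_pos.2 hb)] at hn
    nlinarith [mul_le_mul_of_nonneg_left (hgn n) (sub_pos.2 hb).le]
  rw [div_lt_iff₀ hpos]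
  linarith

/-- The ratio ergodic theorem, for denominators bounded below by `1`. -/
lemma ae_tendsto_birkhoffSum_div (hT : Ergodic T μ) (hfm : Measurable f)
    (hf : Integrable f μ) (hgm : Measurable g) (hg : Integrable g μ) (hg1 : ∀ x, 1 ≤ g x)
    (hg0 : 0 < ∫ x, g x ∂μ) :
    ∀ᵐ x ∂μ, Tendsto (fun n => birkhoffSum T f n x / birkhoffSum T g n x) atTop
      (𝓝 ((∫ x, f x ∂μ) / ∫ x, g x ∂μ)) := by
  -- rational thresholds, so that only countably many null sets are discarded
  have hup : ∀ᵐ x ∂μ, ∀ q : ℚ, (∫ x, f x ∂μ) / (∫ x, g x ∂μ) < q → ∀ b > (q : ℝ),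
      ∀ᶠ n in atTop, birkhoffSum T f n x / birkhoffSum T g n x < b := by
    refine ae_all_iff.2 fun q => ?_
    by_cases hq : (∫ x, f x ∂μ) / (∫ x, g x ∂μ) < q
    · filter_upwards [ae_eventually_birkhoffSum_div_lt hT hfm hf hgm hg hg1
        ((div_lt_iff₀ hg0).1 hq)] with x hx _ using hx
    · simp [hq]
  have hlow : ∀ᵐ x ∂μ, ∀ q : ℚ, (q : ℝ) < (∫ x, f x ∂μ) / (∫ x, g x ∂μ) → ∀ b > -(q : ℝ),
      ∀ᶠ n in atTop, birkhoffSum T (-f) n x / birkhoffSum T g n x < b := by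
    refine ae_all_iff.2 fun q => ?_
    by_cases hq : (q : ℝ) < (∫ x, f x ∂μ) / (∫ x, g x ∂μ)
    · have : ∫ x, (-f) x ∂μ < -(q : ℝ) * ∫ x, g x ∂μ := by
        have := (lt_div_iff₀ hg0).1 hq
        simp only [Pi.neg_apply, integral_neg]
        linarith
      filter_upwards [ae_eventually_birkhoffSum_div_lt hT hfm.neg hf.neg hgm hg hg1 this]
        with x hx _ using hx
    · simp [hq]
  filter_upwards [hup, hlow] with x hx hx'
  refine tendsto_order.2 ⟨fun a ha => ?_, fun b hb => ?_⟩
  · obtain ⟨q, hq1, hq2⟩ := exists_rat_btwn ha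
    filter_upwards [hx' q hq2 (-a) (neg_lt_neg hq1)] with n hn
    rw [birkhoffSum_neg, neg_div] at hn
    exact neg_lt_neg_iff.1 hn
  · obtain ⟨q, hq1, hq2⟩ := exists_rat_btwn hb
    exact hx q hq1 b hq2

end Ergodic

/-! ### Markov chains on path space -/

section PathSpace

open scoped ENNReal

variable {S : Type*}

/-- The cylinder of all sequences that agree with `y` at the times `0, …, n`. -/
def pathCylinder (y : ℕ → S) (n : ℕ) : Set (ℕ → S) := {ω | ∀ i ≤ n, ω i = y i}

/-- The left shift on sequences, which forgets the entry at time `0`. -/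
def pathShift (ω : ℕ → S) : ℕ → S := fun k => ω (k + 1)

lemma pathShift_iterate_apply (n k : ℕ) (ω : ℕ → S) : pathShift^[n] ω k = ω (k + n) := by
  induction n generalizing ω with
  | zero => rfl
  | succ n ih => rw [Function.iterate_succ_apply, ih]; exact congrArg ω (by omega)

lemma birkhoffSum_pathShift (f : S → ℝ) (n : ℕ) (ω : ℕ → S) :
    birkhoffSum pathShift (fun ω => f (ω 0)) n ω = ∑ k ∈ Finset.range n, f (ω k) := by
  simp [birkhoffSum, pathShift_iterate_apply]

lemma pathCylinder_succ (y : ℕ → S) (n : ℕ) :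
    pathCylinder y (n + 1) = {ω | ω 0 = y 0} ∩ pathShift ⁻¹' pathCylinder (pathShift y) n := by
  ext ω
  constructor
  · exact fun h => ⟨h 0 (Nat.zero_le _), fun i hi => h (i + 1) (by omega)⟩
  · rintro ⟨h0, h⟩ i hi
    cases i with
    | zero => exact h0
    | succ i => exact h i (by omega)

lemma isPiSystem_pathCylinder :
    IsPiSystem (Set.range fun p : (ℕ → S) × ℕ => pathCylinder p.1 p.2) := by
  rintro _ ⟨⟨y, n⟩, rfl⟩ _ ⟨⟨z, m⟩, rfl⟩ ⟨ω, hy, hz⟩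
  refine ⟨(ω, max n m), ?_⟩
  ext ω'
  simp only [pathCylinder, Set.mem_ofPred_eq, Set.mem_inter_iff] at hy hz ⊢
  constructor
  · exact fun h => ⟨fun i hi => (h i (le_max_of_le_left hi)).trans (hy i hi),
      fun i hi => (h i (le_max_of_le_right hi)).trans (hz i hi)⟩
  · rintro ⟨h1, h2⟩ i hi
    rcases le_max_iff.1 hi with hi | hi
    · exact (h1 i hi).trans (hy i hi).symm
    · exact (h2 i hi).trans (hz i hi).symm

/-- The path that starts at `x` and moves at time `n` from `s` to `F (n, s)`. -/
def followMaps (x : S) (F : ℕ × S → S) : ℕ → S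
  | 0 => x
  | n + 1 => F (n, followMaps x F n)

variable [MeasurableSpace S]

lemma measurable_pathShift : Measurable (pathShift : (ℕ → S) → ℕ → S) :=
  measurable_pi_lambda _ fun k => measurable_pi_apply (k + 1)

/-- The law on path space of the Markov chain with transition probabilities `Q` started at `x`.
It is realized by following random maps: for each time `n` and state `s` there is an independent
`Q s`-distributed state to which the chain moves if it is in `s` at time `n`. -/
noncomputable def pathLaw (Q : S → PMF S) (x : S) : Measure (ℕ → S) :=
  (Measure.infinitePi fun p : ℕ × S => (Q p.2).toMeasure).map (followMaps x)

/-- The law on path space of the Markov chain with transition probabilities `Q` whose initial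
distribution is the (not necessarily normalized) mass function `m`. -/
noncomputable def mixedPathLaw (Q : S → PMF S) (m : S → ℝ≥0∞) : Measure (ℕ → S) :=
  Measure.sum fun x => m x • pathLaw Q x

lemma mixedPathLaw_apply (Q : S → PMF S) (m : S → ℝ≥0∞) {A : Set (ℕ → S)}
    (hA : MeasurableSet A) : mixedPathLaw Q m A = ∑' x, m x * pathLaw Q x A := by
  simp [mixedPathLaw, Measure.sum_apply _ hA]

/-- An event that is almost sure for a chain with everywhere positive initial masses is almost sure
for every starting point, and hence for every initial distribution. -/
lemma ae_mixedPathLaw_of_ae [Countable S] {Q : S → PMF S} {m m' : S → ℝ≥0∞}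
    (hm0 : ∀ x, m x ≠ 0) {p : (ℕ → S) → Prop} (h : ∀ᵐ ω ∂mixedPathLaw Q m, p ω) :
    ∀ᵐ ω ∂mixedPathLaw Q m', p ω := by
  rw [mixedPathLaw, Measure.ae_sum_iff] at h ⊢
  exact fun x => Measure.ae_smul_measure
    ((Measure.ae_ennreal_smul_measure_iff (hm0 x)).1 (h x)) _

variable [DiscreteMeasurableSpace S]

lemma measurableSet_pathCylinder (y : ℕ → S) (n : ℕ) : MeasurableSet (pathCylinder y n) := by
  have : pathCylinder y n = ⋂ i, ⋂ (_ : i ≤ n), (fun ω : ℕ → S => ω i) ⁻¹' {y i} := by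
    ext ω; simp [pathCylinder]
  rw [this]
  exact .iInter fun i => .iInter fun _ => measurable_pi_apply i (.of_discrete)

variable [Countable S]

lemma generateFrom_pathCylinder : (MeasurableSpace.pi : MeasurableSpace (ℕ → S)) =
    .generateFrom (Set.range fun p : (ℕ → S) × ℕ => pathCylinder p.1 p.2) := by
  apply le_antisymm
  · refine iSup_le fun n => ?_
    rintro _ ⟨t, -, rfl⟩
    -- a set of sequences described by the entry at time `n` is a countable union of cylinders,
    -- one for each possible initial segment of length `n + 1`
    have : (fun ω : ℕ → S => ω n) ⁻¹' t = ⋃ a : {a : Fin (n + 1) → S // a (Fin.last n) ∈ t},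
        pathCylinder (fun i => if h : i < n + 1 then a.1 ⟨i, h⟩ else a.1 0) n := by
      ext ω
      simp only [Set.mem_preimage, Set.mem_iUnion, Subtype.exists]
      constructor
      · intro h
        exact ⟨fun i => ω i, h, fun i hi => by simp [Nat.lt_succ_of_le hi]⟩
      · rintro ⟨a, ha, h⟩
        have := h n le_rfl
        simp only [Nat.lt_succ_self, dite_true] at this
        rw [this]
        exact ha
    rw [this]
    exact MeasurableSet.iUnion fun a =>
      MeasurableSpace.measurableSet_generateFrom ⟨(_, n), rfl⟩
  · refine MeasurableSpace.generateFrom_le ?_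
    rintro _ ⟨p, rfl⟩
    exact measurableSet_pathCylinder _ _

/-- The total masses need not be compared separately, since the space is a countable disjoint union
of cylinders. -/
lemma measure_ext_of_pathCylinder {μ ν : Measure (ℕ → S)} [IsFiniteMeasure μ]
    (h : ∀ y n, μ (pathCylinder y n) = ν (pathCylinder y n)) : μ = ν := by
  refine ext_of_generate_finite _ generateFrom_pathCylinder isPiSystem_pathCylinder ?_ ?_
  · rintro _ ⟨p, rfl⟩
    exact h _ _
  · have huniv : (Set.univ : Set (ℕ → S)) = ⋃ s : S, pathCylinder (fun _ => s) 0 := by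
      ext ω; simp [pathCylinder]
    have hdisj : Pairwise (Function.onFun Disjoint
        fun s : S => pathCylinder (fun _ : ℕ => s) 0) := fun s t hst =>
      Set.disjoint_left.2 fun ω h1 h2 => hst ((h1 0 le_rfl).symm.trans (h2 0 le_rfl))
    rw [huniv, measure_iUnion hdisj fun s => measurableSet_pathCylinder _ _,
      measure_iUnion hdisj fun s => measurableSet_pathCylinder _ _]
    exact tsum_congr fun s => h _ _

lemma measurable_followMaps (x : S) : Measurable (followMaps x) := by
  refine measurable_pi_lambda _ fun n => ?_
  induction n with
  | zero => exact measurable_const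
  | succ n ih =>
    refine measurable_to_countable' fun z => ?_
    have : (fun F : ℕ × S → S => followMaps x F (n + 1)) ⁻¹' {z} =
        ⋃ s, (fun F => followMaps x F n) ⁻¹' {s} ∩ (fun F => F (n, s)) ⁻¹' {z} := by
      ext F; simp [followMaps]
    rw [this]
    exact .iUnion fun s => (ih .of_discrete).inter (measurable_pi_apply _ .of_discrete)

instance (Q : S → PMF S) (x : S) : IsProbabilityMeasure (pathLaw Q x) :=
  Measure.isProbabilityMeasure_map (measurable_followMaps x).aemeasurable

lemma pathLaw_ae_apply_zero (Q : S → PMF S) (x : S) : ∀ᵐ ω ∂pathLaw Q x, ω 0 = x := by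
  have hs : MeasurableSet {ω : ℕ → S | ω 0 = x} :=
    (measurable_pi_apply (X := fun _ => S) 0) (MeasurableSet.of_discrete (s := {x}))
  rw [pathLaw, ae_map_iff (measurable_followMaps x).aemeasurable hs]
  exact .of_forall fun F => rfl

open Classical in
/-- A chain realized by random maps follows `y` up to time `n` if and only if, for each `i < n`, the
map at time `i` sends `y i` to `y (i + 1)`; these events involve distinct coordinates `(i, y i)` of
the product space. -/
lemma pathLaw_pathCylinder (Q : S → PMF S) (x : S) (y : ℕ → S) (n : ℕ) :
    pathLaw Q x (pathCylinder y n) =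
      if y 0 = x then ∏ i ∈ Finset.range n, Q (y i) (y (i + 1)) else 0 := by
  split_ifs with h
  · rw [pathLaw, Measure.map_apply (measurable_followMaps x) (measurableSet_pathCylinder _ _)]
    have hinj : Function.Injective fun i : ℕ => (i, y i) := fun i j hij => (Prod.ext_iff.1 hij).1
    have : followMaps x ⁻¹' pathCylinder y n =
        Set.pi ((Finset.range n).image fun i => (i, y i) : Finset (ℕ × S))
          fun p => {y (p.1 + 1)} := by
      ext F
      simp only [Set.mem_preimage, pathCylinder, Set.mem_ofPred_eq, Set.mem_pi, Finset.coe_image,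
        Set.forall_mem_image, Finset.coe_range, Set.mem_Iio, Set.mem_singleton_iff]
      constructor
      · intro hF i hi
        have := hF (i + 1) hi
        rwa [followMaps, hF i hi.le] at this
      · intro hF i hi
        induction i with
        | zero => exact h.symm
        | succ i ih => rw [followMaps, ih (by omega), hF hi]
    rw [this, Measure.infinitePi_pi _ fun _ _ => .of_discrete,
      Finset.prod_image hinj.injOn]
    exact Finset.prod_congr rfl fun i _ => (Q (y i)).toMeasure_apply_singleton _ .of_discrete
  · refine measure_mono_null (t := {ω | ¬ ω 0 = x}) (fun ω hω h0 => h ?_)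
      (ae_iff.1 (pathLaw_ae_apply_zero Q x))
    rw [← h0, hω 0 (Nat.zero_le _)]

lemma isFiniteMeasure_mixedPathLaw (Q : S → PMF S) {m : S → ℝ≥0∞} (hm : ∑' x, m x ≠ ∞) :
    IsFiniteMeasure (mixedPathLaw Q m) :=
  ⟨by rw [mixedPathLaw_apply Q m .univ]; simpa using hm.lt_top⟩

lemma mixedPathLaw_pathCylinder (Q : S → PMF S) (m : S → ℝ≥0∞) (y : ℕ → S) (n : ℕ) :
    mixedPathLaw Q m (pathCylinder y n) =
      m (y 0) * ∏ i ∈ Finset.range n, Q (y i) (y (i + 1)) := by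
  classical
  rw [mixedPathLaw_apply Q m (measurableSet_pathCylinder _ _), tsum_eq_single (y 0)]
  · simp [pathLaw_pathCylinder]
  · intro x hx
    simp [pathLaw_pathCylinder, hx.symm]

/-- The Markov property at time `1`. -/
lemma map_pathShift_pathLaw (Q : S → PMF S) (x : S) :
    (pathLaw Q x).map pathShift = mixedPathLaw Q (Q x) := by
  have := Measure.isProbabilityMeasure_map (μ := pathLaw Q x)
    (measurable_pathShift (S := S)).aemeasurable
  refine measure_ext_of_pathCylinder fun y n => ?_
  rw [Measure.map_apply measurable_pathShift (measurableSet_pathCylinder _ _),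
    mixedPathLaw_pathCylinder]
  -- `z` is `y` with the starting point `x` put in front
  let z : ℕ → S := fun k => k.casesOn x y
  have hz : pathLaw Q x (pathShift ⁻¹' pathCylinder y n) =
      pathLaw Q x (pathCylinder z (n + 1)) := by
    refine measure_congr ?_
    rw [pathCylinder_succ]
    filter_upwards [pathLaw_ae_apply_zero Q x] with ω hω
    refine propext ⟨fun h => ⟨hω, h⟩, fun h => h.2⟩
  rw [hz, pathLaw_pathCylinder, if_pos (show z 0 = x from rfl), Finset.prod_range_succ', mul_comm]
  rfl

/-- The probability of a shifted event, conditioned on the state at time `1`. -/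
lemma pathLaw_preimage_pathShift (Q : S → PMF S) (x : S) {A : Set (ℕ → S)}
    (hA : MeasurableSet A) :
    pathLaw Q x (pathShift ⁻¹' A) = ∑' y, Q x y * pathLaw Q y A := by
  rw [← Measure.map_apply measurable_pathShift hA, map_pathShift_pathLaw,
    mixedPathLaw_apply _ _ hA]

lemma measurePreserving_pathShift {Q : S → PMF S} {m : S → ℝ≥0∞} (hm : ∑' x, m x ≠ ∞)
    (hinv : ∀ y, ∑' x, m x * Q x y = m y) :
    MeasurePreserving pathShift (mixedPathLaw Q m) (mixedPathLaw Q m) := by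
  have := isFiniteMeasure_mixedPathLaw Q hm
  refine ⟨measurable_pathShift, measure_ext_of_pathCylinder fun y n => ?_⟩
  have hc := measurableSet_pathCylinder y n
  rw [Measure.map_apply measurable_pathShift hc,
    mixedPathLaw_apply _ _ (measurable_pathShift hc), mixedPathLaw_apply _ _ hc]
  simp_rw [pathLaw_preimage_pathShift Q _ hc, ← ENNReal.tsum_mul_left]
  rw [ENNReal.tsum_comm]
  simp_rw [← mul_assoc, ENNReal.tsum_mul_right, hinv]

/-- The Markov property at time `n`, for shift-invariant events. -/
lemma pathLaw_pathCylinder_inter (Q : S → PMF S) {A : Set (ℕ → S)} (hA : MeasurableSet A)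
    (hinv : pathShift ⁻¹' A = A) (x : S) (y : ℕ → S) (n : ℕ) :
    pathLaw Q x (pathCylinder y n ∩ A) =
      pathLaw Q x (pathCylinder y n) * pathLaw Q (y n) A := by
  by_cases h : y 0 = x
  swap
  · classical
    have h0 : pathLaw Q x (pathCylinder y n) = 0 := by rw [pathLaw_pathCylinder, if_neg h]
    rw [h0, zero_mul, measure_mono_null Set.inter_subset_left h0]
  induction n generalizing x y with
  | zero =>
    classical
    have : pathLaw Q x (pathCylinder y 0 ∩ A) = pathLaw Q x A := by
      refine measure_congr ?_
      filter_upwards [pathLaw_ae_apply_zero Q x] with ω hω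
      refine propext ⟨fun hA => hA.2, fun hA => ⟨fun i hi => ?_, hA⟩⟩
      rw [Nat.le_zero.1 hi, hω, h]
    rw [this, pathLaw_pathCylinder, if_pos h, h]
    simp
  | succ n ih =>
    have hih : ∀ z, pathLaw Q z (pathCylinder (pathShift y) n ∩ A) =
        pathLaw Q z (pathCylinder (pathShift y) n) * pathLaw Q (y (n + 1)) A := by
      intro z
      by_cases hz : pathShift y 0 = z
      · exact ih z (pathShift y) hz
      · classical
        have h0 : pathLaw Q z (pathCylinder (pathShift y) n) = 0 := by
          rw [pathLaw_pathCylinder, if_neg hz]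
        rw [h0, zero_mul, measure_mono_null Set.inter_subset_left h0]
    have hc := measurableSet_pathCylinder (pathShift y) n
    have h1 : pathLaw Q x (pathCylinder y (n + 1) ∩ A) =
        pathLaw Q x (pathShift ⁻¹' (pathCylinder (pathShift y) n ∩ A)) := by
      refine measure_congr ?_
      rw [pathCylinder_succ, Set.preimage_inter, hinv]
      filter_upwards [pathLaw_ae_apply_zero Q x] with ω hω
      exact propext ⟨fun h' => ⟨h'.1.2, h'.2⟩, fun h' => ⟨⟨hω.trans h.symm, h'.1⟩, h'.2⟩⟩
    have h2 : pathLaw Q x (pathCylinder y (n + 1)) =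
        pathLaw Q x (pathShift ⁻¹' pathCylinder (pathShift y) n) := by
      refine measure_congr ?_
      rw [pathCylinder_succ]
      filter_upwards [pathLaw_ae_apply_zero Q x] with ω hω
      exact propext ⟨fun h' => h'.2, fun h' => ⟨hω.trans h.symm, h'⟩⟩
    rw [h1, h2, pathLaw_preimage_pathShift Q x (hc.inter hA), pathLaw_preimage_pathShift Q x hc,
      ← ENNReal.tsum_mul_right]
    exact tsum_congr fun z => by rw [hih, mul_assoc]

end PathSpace

/-! ### Bounded harmonic functions -/

section Harmonic

variable {S : Type*}

/-- A bounded harmonic function is constant along the transitions of a chain with a finite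
invariant mass function `m`: the `m`-average of the conditional variance of `φ` after one step is
the difference of the `m`-averages of `φ ^ 2` after and before the step, which vanishes. -/
lemma eq_of_harmonic {m φ : S → ℝ} {q : S → S → ℝ} (hm0 : ∀ x, 0 ≤ m x) (hm : Summable m)
    (hq0 : ∀ x y, 0 ≤ q x y) (hq : ∀ x, HasSum (q x) 1)
    (hinv : ∀ y, HasSum (fun x => m x * q x y) (m y)) (hφ : ∀ x, |φ x| ≤ 1)
    (hharm : ∀ x, HasSum (fun y => q x y * φ y) (φ x)) {x y : S} (hx : m x ≠ 0)
    (hxy : q x y ≠ 0) : φ x = φ y := by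
  have hw0 : ∀ p : S × S, 0 ≤ m p.1 * q p.1 p.2 := fun p => mul_nonneg (hm0 _) (hq0 _ _)
  have hrow : ∀ x, HasSum (fun y => m x * q x y) (m x) := fun x => by
    simpa only [mul_one] using HasSum.mul_left (m x) (hq x)
  have hw : Summable fun p : S × S => m p.1 * q p.1 p.2 := by
    refine (summable_prod_of_nonneg hw0).2 ⟨fun x => (hrow x).summable, ?_⟩
    simpa only [(hrow _).tsum_eq] using hm
  have hbdd : ∀ F : S × S → ℝ, (∀ p, |F p| ≤ 1) →
      Summable fun p : S × S => m p.1 * q p.1 p.2 * F p := fun F hF =>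
    Summable.of_norm_bounded hw fun p => by
      rw [Real.norm_eq_abs, abs_mul, abs_of_nonneg (hw0 p)]
      exact mul_le_of_le_one_right (hw0 p) (hF p)
  have hmul : ∀ a b, |φ a * φ b| ≤ 1 := fun a b => by
    rw [abs_mul]
    exact mul_le_one₀ (hφ a) (abs_nonneg _) (hφ b)
  have hxx := (hbdd (fun p => φ p.1 * φ p.1) fun p => hmul _ _).hasSum
  have hxy' := (hbdd (fun p => φ p.1 * φ p.2) fun p => hmul _ _).hasSum
  have hyy := (hbdd (fun p => φ p.2 * φ p.2) fun p => hmul _ _).hasSum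
  have e1 := hxx.prod_fiberwise (g := fun x => m x * (φ x * φ x)) fun x => by
    exact HasSum.mul_right (φ x * φ x) (hrow x)
  have e2 := hxy'.prod_fiberwise (g := fun x => m x * (φ x * φ x)) fun x => by
    have := HasSum.mul_left (m x * φ x) (hharm x)
    rw [mul_assoc] at this
    exact this.congr_fun fun y => by ring
  have e3 := ((Equiv.prodComm S S).hasSum_iff.2 hyy).prod_fiberwise
    (g := fun x => m x * (φ x * φ x)) fun y => by
      exact HasSum.mul_right (φ y * φ y) (hinv y)
  rw [e1.unique e2] at hxx
  rw [e3.unique e2] at hyy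
  have hsq : HasSum (fun p : S × S => m p.1 * q p.1 p.2 * (φ p.1 - φ p.2) ^ 2) 0 := by
    have := (hxx.sub (HasSum.mul_left 2 hxy')).add hyy
    rw [show ∀ a : ℝ, a - 2 * a + a = 0 by intro a; ring] at this
    exact this.congr_fun fun p => by ring
  have := congrFun ((hasSum_zero_iff_of_nonneg
    fun p => mul_nonneg (hw0 p) (sq_nonneg _)).1 hsq) (x, y)
  simp only [Pi.zero_apply, mul_eq_zero, hx, hxy, false_or] at this
  exact sub_eq_zero.1 (pow_eq_zero_iff two_ne_zero |>.1 this)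

end Harmonic

/-! ### Ergodicity of the shift -/

section Ergodicity

open scoped ENNReal

lemma ENNReal.hasSum_toReal_of_tsum_eq {ι : Type*} {f : ι → ℝ≥0∞} {a : ℝ≥0∞}
    (h : ∑' i, f i = a) (ha : a ≠ ∞) : HasSum (fun i => (f i).toReal) a.toReal := by
  have hne : ∑' i, f i ≠ ∞ := h ▸ ha
  rw [← h, ENNReal.tsum_toReal_eq (ENNReal.ne_top_of_tsum_ne_top hne)]
  exact ENNReal.hasSum_toReal hne

variable {S : Type*} [MeasurableSpace S] [DiscreteMeasurableSpace S] [Countable S]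
  {Q : S → PMF S} {m : S → ℝ≥0∞}

/-- For an irreducible chain with a finite invariant mass function, the probability of a
shift-invariant event does not depend on the starting point: it is a harmonic function of it. -/
lemma pathLaw_eq_of_preimage_pathShift_eq (hm : ∑' x, m x ≠ ∞)
    (hinv : ∀ y, ∑' x, m x * Q x y = m y) (hm0 : ∀ x, m x ≠ 0)
    (hirr : ∀ x y, Relation.ReflTransGen (fun a b => Q a b ≠ 0) x y) {A : Set (ℕ → S)}
    (hA : MeasurableSet A) (hAinv : pathShift ⁻¹' A = A) (x y : S) :
    pathLaw Q x A = pathLaw Q y A := by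
  have hm_top := ENNReal.ne_top_of_tsum_ne_top hm
  have hstep : ∀ a b, Q a b ≠ 0 → pathLaw Q a A = pathLaw Q b A := by
    intro a b hab
    have := eq_of_harmonic (m := fun x => (m x).toReal) (φ := fun x => (pathLaw Q x A).toReal)
      (q := fun x y => (Q x y).toReal) (fun _ => ENNReal.toReal_nonneg)
      (ENNReal.summable_toReal hm) (fun _ _ => ENNReal.toReal_nonneg)
      (fun x => by
        simpa using ENNReal.hasSum_toReal_of_tsum_eq (Q x).tsum_coe ENNReal.one_ne_top)
      (fun y => by
        simpa using ENNReal.hasSum_toReal_of_tsum_eq (hinv y) (hm_top y))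
      (fun x => by
        rw [abs_of_nonneg ENNReal.toReal_nonneg]
        exact ENNReal.toReal_le_of_le_ofReal zero_le_one (by simpa using prob_le_one))
      (fun x => by
        have h := pathLaw_preimage_pathShift Q x hA
        rw [hAinv] at h
        simpa using ENNReal.hasSum_toReal_of_tsum_eq h.symm (measure_ne_top _ _))
      (ENNReal.toReal_ne_zero.2 ⟨hm0 a, hm_top a⟩)
      (ENNReal.toReal_ne_zero.2 ⟨hab, (Q a).apply_ne_top b⟩)
    exact (ENNReal.toReal_eq_toReal_iff' (measure_ne_top _ _) (measure_ne_top _ _)).1 this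
  induction hirr x y with
  | refl => rfl
  | tail _ hbc ih => exact ih.trans (hstep _ _ hbc)

/-- The shift is ergodic for an irreducible chain with a finite invariant mass function: an
invariant event is independent of all cylinders, hence of itself. -/
lemma ergodic_pathShift (hm : ∑' x, m x ≠ ∞)
    (hinv : ∀ y, ∑' x, m x * Q x y = m y) (hm0 : ∀ x, m x ≠ 0)
    (hirr : ∀ x y, Relation.ReflTransGen (fun a b => Q a b ≠ 0) x y) :
    Ergodic pathShift (mixedPathLaw Q m) where
  toMeasurePreserving := measurePreserving_pathShift hm hinv
  aeconst_set A hA hAinv := by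
    have := isFiniteMeasure_mixedPathLaw Q hm
    obtain ⟨c, hc⟩ : ∃ c, ∀ x, pathLaw Q x A = c := by
      rcases isEmpty_or_nonempty S with hS | ⟨⟨s⟩⟩
      · exact ⟨0, fun x => hS.elim x⟩
      · exact ⟨_, fun x => pathLaw_eq_of_preimage_pathShift_eq hm hinv hm0 hirr hA hAinv x s⟩
    have hrestrict : (mixedPathLaw Q m).restrict A = c • mixedPathLaw Q m := by
      refine measure_ext_of_pathCylinder fun y n => ?_
      have hcyl := measurableSet_pathCylinder y n
      rw [Measure.restrict_apply hcyl, Measure.smul_apply, smul_eq_mul,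
        mixedPathLaw_apply _ _ (hcyl.inter hA), mixedPathLaw_apply _ _ hcyl,
        ← ENNReal.tsum_mul_left]
      refine tsum_congr fun x => ?_
      rw [pathLaw_pathCylinder_inter Q hA hAinv, hc]
      ring
    have hcompl : c * mixedPathLaw Q m Aᶜ = 0 := by
      have := congrArg (fun μ : Measure (ℕ → S) => μ Aᶜ) hrestrict
      simpa [Measure.restrict_apply hA.compl] using this.symm
    rcases mul_eq_zero.1 hcompl with h | h
    · refine eventuallyConst_set.2 (Or.inr (measure_eq_zero_iff_ae_notMem.1 ?_))
      simp [mixedPathLaw_apply Q m hA, hc, h]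
    · exact eventuallyConst_set.2 (Or.inl (mem_ae_iff.2 h))

lemma mixedPathLaw_map_apply_zero (Q : S → PMF S) (m : S → ℝ≥0∞) (x : S) :
    (mixedPathLaw Q m).map (fun ω => ω 0) {x} = m x := by
  rw [Measure.map_apply (measurable_pi_apply 0) .of_discrete]
  have : (fun ω : ℕ → S => ω 0) ⁻¹' {x} = pathCylinder (fun _ => x) 0 := by
    ext ω; simp [pathCylinder]
  rw [this, mixedPathLaw_pathCylinder]
  simp

lemma integrable_mixedPathLaw_apply_zero {w f : S → ℝ} (hw : ∀ x, 0 ≤ w x)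
    (hf : Summable fun x => w x * |f x|) :
    Integrable (fun ω => f (ω 0)) (mixedPathLaw Q fun x => .ofReal (w x)) := by
  refine Integrable.comp_measurable (g := f) ⟨measurable_of_countable f |>.aestronglyMeasurable, ?_⟩
    (measurable_pi_apply 0)
  have h : ∀ x, ‖f x‖ₑ * ENNReal.ofReal (w x) = ENNReal.ofReal (w x * |f x|) := fun x => by
    rw [mul_comm, ENNReal.ofReal_mul (hw x), Real.enorm_eq_ofReal_abs]
  rw [HasFiniteIntegral, lintegral_countable']
  simp_rw [mixedPathLaw_map_apply_zero, h]
  exact hf.tsum_ofReal_lt_top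

lemma integral_mixedPathLaw_apply_zero {w f : S → ℝ} (hw : ∀ x, 0 ≤ w x)
    (hf : Summable fun x => w x * |f x|) :
    ∫ ω, f (ω 0) ∂(mixedPathLaw Q fun x => .ofReal (w x)) = ∑' x, w x * f x := by
  have hmeas : Measurable fun ω : ℕ → S => ω 0 := measurable_pi_apply 0
  have hfm := (measurable_of_countable f).aestronglyMeasurable
    (μ := (mixedPathLaw Q fun x => .ofReal (w x)).map fun ω => ω 0)
  rw [← integral_map hmeas.aemeasurable hfm, integral_countable
    ((integrable_map_measure hfm hmeas.aemeasurable).2 (integrable_mixedPathLaw_apply_zero hw hf))]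
  refine tsum_congr fun x => ?_
  rw [measureReal_def, mixedPathLaw_map_apply_zero, ENNReal.toReal_ofReal (hw x), smul_eq_mul]

end Ergodicity

/-! ### The jump chain -/

namespace JumpChain

open scoped ENNReal

variable {S : Type*}

section Transition

variable {P : S → S → ℝ} {π : S → ℝ}

/-- The distribution `P x` as a probability mass function. -/
noncomputable def IsTransition.toPMF (hP : IsTransition P) (x : S) : PMF S :=
  ⟨fun y => ENNReal.ofReal (P x y), by
    rw [← ENNReal.ofReal_one, ← (hP x).hasSum_one.tsum_eq,
      ENNReal.ofReal_tsum_of_nonneg (hP x).nonneg (hP x).hasSum_one.summable]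
    exact ENNReal.summable.hasSum⟩

lemma IsTransition.toPMF_apply (hP : IsTransition P) (x y : S) :
    hP.toPMF x y = ENNReal.ofReal (P x y) := rfl

lemma IsTransition.add_le_one (hP : IsTransition P) {x y z : S} (hyz : y ≠ z) :
    P x y + P x z ≤ 1 := by
  classical
  simpa [Finset.sum_pair hyz] using
    sum_le_hasSum {y, z} (fun i _ => (hP x).nonneg i) (hP x).hasSum_one

lemma escape_le_one (hP : IsTransition P) (x : S) : escape P x ≤ 1 :=
  sub_le_self 1 ((hP x).nonneg x)

lemma escape_pos [Nontrivial S] (hP : IsTransition P) (hirr : Irreducible P) (x : S) :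
    0 < escape P x := by
  obtain ⟨y, hy⟩ := exists_ne x
  by_contra! hle
  -- a state with escape probability `0` is absorbing
  refine hy ?_
  induction hirr x y with
  | refl => rfl
  | @tail b c _ hbc ih =>
    by_contra hc
    have hb : b = x := by_contra fun hb => hb (ih hb)
    rw [hb] at hbc
    have := hP.add_le_one (x := x) (Ne.symm hc)
    unfold escape at hle
    linarith

lemma jump_of_ne {x y : S} (h : y ≠ x) : jump P x y = P x y / escape P x := if_neg h

lemma isTransition_jump (hP : IsTransition P) (hα : ∀ x, 0 < escape P x) :
    IsTransition (jump P) := by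
  classical
  refine fun x => ⟨fun y => ?_, ?_⟩
  · unfold jump
    split_ifs
    · exact le_rfl
    · exact div_nonneg ((hP x).nonneg y) (hα x).le
  · have := HasSum.div_const (hasSum_ite_sub_hasSum (hP x).hasSum_one x) (escape P x)
    rw [show (1 - P x x) / escape P x = 1 from div_self (hα x).ne'] at this
    refine this.congr_fun fun y => ?_
    unfold jump
    split_ifs <;> simp

lemma irreducible_jump (hα : ∀ x, 0 < escape P x) (hirr : Irreducible P) :
    Irreducible (jump P) := by
  intro x y
  induction hirr x y with
  | refl => exact .refl
  | @tail b c _ hbc ih =>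
    -- steps from a state to itself can be left out of a path
    rcases eq_or_ne c b with rfl | hne
    · exact ih
    · exact ih.tail (by rw [jump_of_ne hne]; exact div_pos hbc (hα b))

lemma IsStationary.pos (hP : IsTransition P) (hirr : Irreducible P) (hπ : IsStationary P π)
    (x : S) : 0 < π x := by
  obtain ⟨x₀, hx₀⟩ : ∃ x₀, 0 < π x₀ := by
    by_contra! hle
    have h0 : π = 0 := funext fun x => le_antisymm (hle x) (hπ.isDistribution.nonneg x)
    have h1 := hπ.isDistribution.hasSum_one
    rw [h0] at h1
    exact zero_ne_one (hasSum_zero.unique h1)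
  induction hirr x₀ x with
  | refl => exact hx₀
  | @tail b c _ hbc ih =>
    exact (mul_pos ih hbc).trans_le (le_hasSum (hπ.hasSum_eq c) b
      fun z _ => mul_nonneg (hπ.isDistribution.nonneg z) ((hP z).nonneg c))

/-- The masses `π x * α x` are invariant under the jump chain. -/
lemma IsStationary.hasSum_jump (hα : ∀ x, 0 < escape P x) (hπ : IsStationary P π) (y : S) :
    HasSum (fun x => π x * escape P x * jump P x y) (π y * escape P y) := by
  classical
  have := hasSum_ite_sub_hasSum (hπ.hasSum_eq y) y
  rw [show π y - π y * P y y = π y * escape P y by unfold escape; ring] at this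
  refine this.congr_fun fun x => ?_
  rcases eq_or_ne x y with rfl | hne
  · simp [jump]
  · rw [jump_of_ne hne.symm, if_neg hne]
    field_simp [(hα x).ne']

end Transition

variable {Ω : Type*} [MeasurableSpace Ω] {μ : Measure Ω} {Q : S → S → ℝ} {J : ℕ → Ω → S}

/-- The finite-dimensional distributions of a Markov chain. -/
lemma IsMarkovChain.measure_eq [IsFiniteMeasure μ] (hJ : IsMarkovChain μ Q J)
    (hQ : IsTransition Q) (y : ℕ → S) (n : ℕ) :
    μ {ω | ∀ i ≤ n, J i ω = y i} =
      μ {ω | J 0 ω = y 0} * ∏ i ∈ Finset.range n, hQ.toPMF (y i) (y (i + 1)) := by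
  induction n with
  | zero => simp
  | succ n ih =>
    rw [Finset.prod_range_succ, ← mul_assoc, ← ih, ← ofReal_measureReal, hJ.step,
      ENNReal.ofReal_mul measureReal_nonneg, ofReal_measureReal, hQ.toPMF_apply]

variable [Countable S]

lemma IsMarkovChain.measurable_path [MeasurableSpace S] (hJ : IsMarkovChain μ Q J) :
    Measurable fun ω n => J n ω :=
  measurable_pi_lambda _ fun n => measurable_to_countable' (hJ.measurableSet_eq n)

/-- The law of a Markov chain on any probability space is the law on path space constructed from
random maps, with the same initial distribution. -/
lemma IsMarkovChain.map_path [MeasurableSpace S] [DiscreteMeasurableSpace S] [IsFiniteMeasure μ]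
    (hJ : IsMarkovChain μ Q J) (hQ : IsTransition Q) :
    μ.map (fun ω n => J n ω) = mixedPathLaw hQ.toPMF fun x => μ {ω | J 0 ω = x} := by
  refine measure_ext_of_pathCylinder fun y n => ?_
  rw [Measure.map_apply hJ.measurable_path (measurableSet_pathCylinder y n),
    mixedPathLaw_pathCylinder, ← hJ.measure_eq hQ y n]
  rfl

/-- The ratio ergodic theorem for an irreducible Markov chain with a finite positive invariant mass
function `w` and an arbitrary initial distribution. -/
lemma IsMarkovChain.ae_tendsto_sum_div_sum [MeasurableSpace S] [DiscreteMeasurableSpace S]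
    [IsFiniteMeasure μ] (hJ : IsMarkovChain μ Q J) (hQ : IsTransition Q)
    (hirr : Irreducible Q) {w f g : S → ℝ} (hw : ∀ x, 0 < w x) (hw_sum : Summable w)
    (hinv : ∀ y, HasSum (fun x => w x * Q x y) (w y))
    (hf : Summable fun x => w x * |f x|) (hg : Summable fun x => w x * |g x|)
    (hg1 : ∀ x, 1 ≤ g x) (hg0 : 0 < ∑' x, w x * g x) :
    ∀ᵐ ω ∂μ, Tendsto
      (fun L : ℕ => (∑ k ∈ Finset.range L, f (J k ω)) / ∑ k ∈ Finset.range L, g (J k ω))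
      atTop (𝓝 ((∑' x, w x * f x) / ∑' x, w x * g x)) := by
  have hw0 : ∀ x, 0 ≤ w x := fun x => (hw x).le
  have herg : Ergodic pathShift (mixedPathLaw hQ.toPMF fun x => .ofReal (w x)) := by
    refine ergodic_pathShift hw_sum.tsum_ofReal_ne_top (fun y => ?_)
      (fun x => (ENNReal.ofReal_pos.2 (hw x)).ne') fun x y => ?_
    · simp_rw [hQ.toPMF_apply, ← ENNReal.ofReal_mul (hw0 _)]
      rw [← ENNReal.ofReal_tsum_of_nonneg
        (fun x => mul_nonneg (hw0 x) ((hQ x).nonneg y)) (hinv y).summable, (hinv y).tsum_eq]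
    · have hpos : ∀ a b, 0 < Q a b → hQ.toPMF a b ≠ 0 := fun a b hab => by
        rw [hQ.toPMF_apply]
        exact (ENNReal.ofReal_pos.2 hab).ne'
      exact Relation.ReflTransGen.mono hpos x y (hirr x y)
  have hf_int := integral_mixedPathLaw_apply_zero (Q := hQ.toPMF) (f := f) hw0 hf
  have hg_int := integral_mixedPathLaw_apply_zero (Q := hQ.toPMF) (f := g) hw0 hg
  have hmeas : ∀ f : S → ℝ, Measurable fun ω : ℕ → S => f (ω 0) := fun f =>
    (measurable_of_countable f).comp (measurable_pi_apply (X := fun _ => S) 0)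
  have hratio := ae_tendsto_birkhoffSum_div herg
    (f := fun ω : ℕ → S => f (ω 0)) (g := fun ω : ℕ → S => g (ω 0))
    (hmeas f) (integrable_mixedPathLaw_apply_zero (f := f) hw0 hf)
    (hmeas g) (integrable_mixedPathLaw_apply_zero (f := g) hw0 hg) (fun ω => hg1 (ω 0))
    (by rwa [hg_int])
  rw [hf_int, hg_int] at hratio
  simp only [birkhoffSum_pathShift] at hratio
  have hJlaw := ae_mixedPathLaw_of_ae (m' := fun x => μ {ω | J 0 ω = x})
    (fun x => (ENNReal.ofReal_pos.2 (hw x)).ne') hratio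
  rw [← hJ.map_path hQ] at hJlaw
  exact ae_of_ae_map hJ.measurable_path.aemeasurable hJlaw

end JumpChain

theorem theorem2 {S : Type*} [Countable S] [Nontrivial S]
    (P : S → S → ℝ) (hP : JumpChain.IsTransition P) (hirr : JumpChain.Irreducible P)
    (π : S → ℝ) (hπ : JumpChain.IsStationary P π)
    {Ω : Type*} [MeasurableSpace Ω] (μ : Measure Ω) [IsProbabilityMeasure μ]
    (J : ℕ → Ω → S) (hJ : JumpChain.IsMarkovChain μ (JumpChain.jump P) J)
    (h : S → ℝ) (hh : Summable (fun x => |h x| * π x)) :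
    ∀ᵐ ω ∂μ, Tendsto
      (fun L : ℕ =>
        (∑ k ∈ Finset.range L, h (J k ω) / JumpChain.escape P (J k ω)) /
          (∑ k ∈ Finset.range L, 1 / JumpChain.escape P (J k ω)))
      atTop (𝓝 (∑' x, h x * π x)) := by
  let _ : MeasurableSpace S := ⊤
  have _ : DiscreteMeasurableSpace S := ⟨fun _ => trivial⟩
  have hα := JumpChain.escape_pos hP hirr
  have hπα : ∀ x, 0 < π x * JumpChain.escape P x := fun x => mul_pos (hπ.pos hP hirr x) (hα x)
  have hπα_sum : Summable fun x => π x * JumpChain.escape P x :=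
    hπ.isDistribution.hasSum_one.summable.of_nonneg_of_le (fun x => (hπα x).le) fun x =>
      mul_le_of_le_one_right (hπ.isDistribution.nonneg x) (JumpChain.escape_le_one hP x)
  -- the weight `α` in the invariant masses of the jump chain cancels the division by `α`
  have hcancel : ∀ x a, π x * JumpChain.escape P x * (a / JumpChain.escape P x) = a * π x :=
    fun x a => by field_simp [(hα x).ne']
  have hf : Summable fun x =>
      π x * JumpChain.escape P x * |h x / JumpChain.escape P x| := by
    simpa only [abs_div, abs_of_pos (hα _), hcancel] using hh
  have hg : Summable fun x =>
      π x * JumpChain.escape P x * |1 / JumpChain.escape P x| := by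
    simpa only [abs_div, abs_of_pos (hα _), hcancel, abs_one, one_mul] using
      hπ.isDistribution.hasSum_one.summable
  have hg_one : ∑' x, π x * JumpChain.escape P x * (1 / JumpChain.escape P x) = 1 := by
    simp only [hcancel, one_mul, hπ.isDistribution.hasSum_one.tsum_eq]
  have := hJ.ae_tendsto_sum_div_sum (JumpChain.isTransition_jump hP hα)
    (JumpChain.irreducible_jump hα hirr) hπα hπα_sum (hπ.hasSum_jump hα) hf hg
    (fun x => one_le_one_div (hα x) (JumpChain.escape_le_one hP x)) (by rw [hg_one]; exact one_pos)
  rw [hg_one, div_one] at this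
  simpa only [hcancel] using this
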